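/- Let $\Bbbk$ be a field and let $\mathrm{Var}$ be a multilinear variety of (non-associative) $\Bbbk$-algebras with a family of bilinear operations $(a,b)\mapsto a\cdot_i b$, $i\in I$ (for ordinary algebras $|I|=1$ and the index $i$ is omitted), i.e. the class of all such algebras satisfying a given set of multilinear identities. For $A\in\mathrm{Var}$ and a derivation $d$ of $A$ (a linear map with $d(a\cdot_i b)=d(a)\cdot_i b+a\cdot_i d(b)$ for all $i$), let $A^{(d*)}$ be the space $A$ with the operations $$a\prec_i b=a\cdot_i d(b),\qquad a\succ_i b=d(a)\cdot_i b,\qquad a\cdot_i b .$$ A multilinear non-associative polynomial $f(x_1,\dots,x_n)$ in the operations $\prec_i,\succ_i,\cdot_i$ is a *generalized derived identity* of $\mathrm{Var}$ if $f=0$ holds on $A^{(d*)}$ for every $A\in\mathrm{Var}$ and every derivation $d$ of $A$. Let $\mathrm{GD}$ be the quadratic operad of Gelfand–Dorfman algebras, i.e. spaces with a Lie bracket $[\cdot,\cdot]$ and an operation $\circ$ such that $(a\circ b)\circ c-a\circ(b\circ c)=(b\circ a)\circ c-b\circ(a\circ c)$, $(a\circ b)\circ c=(a\circ c)\circ b$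 and $[a,b\circ c]-[c,b\circ a]+[b,a]\circ c-[b,c]\circ a-b\circ[a,c]=0$. Let $\mathrm{GD}^!$ be its Koszul dual; explicitly, a $\mathrm{GD}^!$-algebra has an associative commutative operation $\ast$ and an operation $\star$ with $$(x\star y)\star z-x\star(y\star z)=(x\star z)\star y-x\star(z\star y),\qquad x\star(y\star z)=y\star(x\star z),$$ $$x\star(y\ast z)=(x\star y)\ast z,\qquad x\star(y\ast z)+y\star(x\ast z)=(x\ast y)\star z .$$ For a multilinear variety $\mathcal P$ let $\mathcal P(n)$ be the space of multilinear polynomials in $x_1,\dots,x_n$ modulo the identities of $\mathcal P$; these spaces form the operad of $\mathcal P$. The Manin white product $\mathrm{Var}\circ\mathrm{GD}^!$ is the sub-operad of the Hadamard product $(\mathrm{Var}(n)\otimes\mathrm{GD}^!(n))_{n\ge1}$ generated by $\mathrm{Var}(2)\otimes\mathrm{GD}^!(2)$. It is generated by $$x_1\succ_i x_2=(x_1\cdot_i x_2)\otimes(x_1\star x_2),\quad x_1\prec_i x_2=(x_1\cdot_i x_2)\otimes(x_2\star x_1),\quad (x_1\cdot_i x_2)\otimes(x_1\ast x_2),$$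 the last one being denoted again by $x_1\cdot_i x_2$, so that a $(\mathrm{Var}\circ\mathrm{GD}^!)$-algebra is a space with bilinear operations $\prec_i,\succ_i,\cdot_i$ ($i\in I$) that satisfies every multilinear identity in these operations which holds for the generators in this operad. **Theorem.** Every multilinear generalized derived identity of $\mathrm{Var}$ holds on all $(\mathrm{Var}\circ\mathrm{GD}^!)$-algebras. -/

import Mathlib

open scoped TensorProduct

universe u v w

namespace GDWhite

/-! ## Non-associative multilinear polynomials and varieties -/

/-- Non-associative monomials in the variables `α` with binary operation symbols `Ω`. -/
inductive Mon (Ω : Type*) (α : Type*) where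
  | var (a : α) : Mon Ω α
  | op (o : Ω) (s t : Mon Ω α) : Mon Ω α

/-- The number of occurrences of the variable `a` in a monomial. -/
def Mon.occ {Ω α : Type*} [DecidableEq α] (a : α) : Mon Ω α → ℕ
  | .var b => if b = a then 1 else 0
  | .op _ s t => s.occ a + t.occ a

/-- Multilinear monomials of degree `n`: each of `x_1, …, x_n` occurs exactly once. -/
abbrev MultMon (Ω : Type*) (n : ℕ) := {t : Mon Ω (Fin n) // ∀ i, t.occ i = 1}

/-- The space `M_n` of multilinear non-associative polynomials in `x_1, …, x_n`
with operation symbols `Ω`. -/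
abbrev MPoly (k : Type*) [Field k] (Ω : Type*) (n : ℕ) := MultMon Ω n →₀ k

/-- A system of bilinear operations on `A` indexed by `Ω`. -/
abbrev Ops (k : Type*) [Field k] (Ω : Type*) (A : Type*) [AddCommGroup A] [Module k A] :=
  Ω → A →ₗ[k] A →ₗ[k] A

section Eval

variable {k : Type*} [Field k] {Ω : Type*} {A : Type*} [AddCommGroup A] [Module k A]

/-- The value of a monomial. -/
def Mon.eval {α : Type*} (m : Ops k Ω A) (x : α → A) : Mon Ω α → A
  | .var a => x a
  | .op o s t => m o (s.eval m x) (t.eval m x)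

/-- The value of a multilinear polynomial, as a linear map in the polynomial. -/
noncomputable def MPoly.eval {n : ℕ} (m : Ops k Ω A) (x : Fin n → A) : MPoly k Ω n →ₗ[k] A :=
  Finsupp.linearCombination k fun t : MultMon Ω n => t.1.eval m x

/-- The identity `f = 0` holds on the algebra `(A, m)`. -/
def Holds {n : ℕ} (m : Ops k Ω A) (f : MPoly k Ω n) : Prop :=
  ∀ x : Fin n → A, MPoly.eval m x f = 0

end Eval

/-- A class of algebras over `k` with operation symbols `Ω`. -/
abbrev AlgClass (k : Type u) [Field k] (Ω : Type v) :=
  ∀ (A : Type w) [AddCommGroup A] [Module k A], Ops k Ω A → Prop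

/-- The multilinear variety defined by the set of multilinear identities `rel`. -/
def Variety {k : Type u} [Field k] {Ω : Type v} (rel : ∀ n : ℕ, Set (MPoly k Ω n)) :
    AlgClass.{u, v, w} k Ω :=
  fun _A _ _ m => ∀ n, ∀ f ∈ rel n, Holds m f

/-- `M_n ∩ T`, where `T` is the T-ideal of all identities that hold on the class `V`. -/
def identities {k : Type u} [Field k] {Ω : Type v} (V : AlgClass.{u, v, w} k Ω) (n : ℕ) :
    Submodule k (MPoly k Ω n) where
  carrier := {f | ∀ (A : Type w) [AddCommGroup A] [Module k A] (m : Ops k Ω A),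
    V A m → Holds m f}
  zero_mem' := fun _ _ _ _ _ _ => map_zero _
  add_mem' := fun hf hg A _ _ m hm x => by
    rw [map_add, hf A m hm x, hg A m hm x, add_zero]
  smul_mem' := fun c f hf A _ _ m hm x => by
    rw [map_smul, hf A m hm x, smul_zero]

/-- The component of arity `n` of the operad of the class `V`, namely `M_n / (M_n ∩ T)`. -/
abbrev OperadComp {k : Type u} [Field k] {Ω : Type v} (V : AlgClass.{u, v, w} k Ω) (n : ℕ) :=
  MPoly k Ω n ⧸ identities V n

/-! ## The Koszul dual `GD^!` of the operad of Gelfand-Dorfman algebras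

A GD-algebra has a Lie bracket `[a, b]` and an operation `a ∘ b` such that
* `(a ∘ b) ∘ c - a ∘ (b ∘ c) = (b ∘ a) ∘ c - b ∘ (a ∘ c)`, `(a ∘ b) ∘ c = (a ∘ c) ∘ b`,
* `[a, b ∘ c] - [c, b ∘ a] + [b, a] ∘ c - [b, c] ∘ a - b ∘ [a, c] = 0`. -/

/-- The basis `[x₁, x₂]`, `x₁ ∘ x₂`, `x₂ ∘ x₁` of `GD(2)`. -/
inductive GDGen where
  | br : GDGen
  | circ : GDGen
  | circOp : GDGen
  deriving DecidableEq

instance : Fintype GDGen := ⟨{.br, .circ, .circOp}, by rintro (_ | _ | _) <;> decide⟩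

/-- The space `O₃ = k S₃ ⊗_{k S₂} (GD(2) ⊗ GD(2))` of multilinear terms of degree 3, in
coordinates: the basis vector `(c, p, q)` is the term `p(q(x_{c+1}, x_{c+2}), x_c)`, where the
numbers of the variables are taken modulo 3. -/
abbrev O3 (k : Type*) := Fin 3 × GDGen × GDGen → k

/-- The term `p(q(x_a, x_b), x_c)` as an element of `O₃`, for `{a, b, c} = {0, 1, 2}`. -/
def term (k : Type*) [Field k] (p q : GDGen) (a b c : Fin 3) : O3 k :=
  if b = a + 1 then Pi.single (c, p, q) 1 else
    match q with
    | .br => -Pi.single (c, p, .br) 1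
    | .circ => Pi.single (c, p, .circOp) 1
    | .circOp => Pi.single (c, p, .circ) 1

/-- The `S₃`-orbits of the defining relations of GD-algebras of degree 3; in this order: the
Jacobi identity, left symmetry, right commutativity, and the compatibility of the operations. -/
inductive GDRel (k : Type*) [Field k] : O3 k → Prop where
  | jacobi (s : Equiv.Perm (Fin 3)) : GDRel k
      (term k .br .br (s 0) (s 1) (s 2) + term k .br .br (s 1) (s 2) (s 0)
        + term k .br .br (s 2) (s 0) (s 1))
  | lsymm (s : Equiv.Perm (Fin 3)) : GDRel k
      (term k .circ .circ (s 0) (s 1) (s 2) - term k .circOp .circ (s 1) (s 2) (s 0)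
        - term k .circ .circ (s 1) (s 0) (s 2) + term k .circOp .circ (s 0) (s 2) (s 1))
  | rcomm (s : Equiv.Perm (Fin 3)) : GDRel k
      (term k .circ .circ (s 0) (s 1) (s 2) - term k .circ .circ (s 0) (s 2) (s 1))
  | compat (s : Equiv.Perm (Fin 3)) : GDRel k
      (-term k .br .circ (s 1) (s 2) (s 0) + term k .br .circ (s 1) (s 0) (s 2)
        + term k .circ .br (s 1) (s 0) (s 2) - term k .circ .br (s 1) (s 2) (s 0)
        - term k .circOp .br (s 0) (s 2) (s 1))

/-- The operations `∗` and `⋆` of a `GD^!`-algebra, dual to `[·,·]` and `∘`. -/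
inductive GDDualOp where
  | ast : GDDualOp
  | star : GDDualOp

section GDDual

variable {k : Type*} [Field k] {A : Type*} [AddCommGroup A] [Module k A]

/-- The basis of `GD(2)^∨ = GD(2)^* ⊗ sgn` dual to `[x₁, x₂]`, `x₁ ∘ x₂`, `x₂ ∘ x₁`, where
`∗` and `⋆` are dual to the first two vectors. The transposition takes the dual of `x₁ ∘ x₂`
to minus the dual of `x₂ ∘ x₁`, because of the sign twist. -/
def dualOp (m : Ops k GDDualOp A) : GDGen → A →ₗ[k] A →ₗ[k] A
  | .br => m .ast
  | .circ => m .star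
  | .circOp => -(m .star).flip

/-- `GD^!`-algebras: algebras over the Koszul dual of the quadratic operad of GD-algebras.
The sign twist turns the skew-symmetric bracket into a commutative operation `∗`, and the
relations of degree 3 are the orthogonal complement of the space spanned by the relations of
GD-algebras (the cyclic permutations that occur in the basis of `O₃` are even,
so the sign-twisted pairing of the basis with the dual one is the plain one). -/
def IsGDDual (m : Ops k GDDualOp A) : Prop :=
  (∀ x y, m .ast x y = m .ast y x) ∧
  ∀ r : O3 k, (∀ g : O3 k, GDRel k g → ∑ i, r i * g i = 0) →
    ∀ x : Fin 3 → A,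
      ∑ i, r i • dualOp m i.2.1 (dualOp m i.2.2 (x (i.1 + 1)) (x (i.1 + 2))) (x i.1) = 0

theorem sum_O3 {M : Type*} [AddCommMonoid M] (F : Fin 3 × GDGen × GDGen → M) :
    ∑ i, F i = ∑ c, (((F (c, .br, .br) + F (c, .br, .circ)) + F (c, .br, .circOp)) +
      (F (c, .circ, .br) + F (c, .circ, .circ) + F (c, .circ, .circOp)) +
      (F (c, .circOp, .br) + F (c, .circOp, .circ) + F (c, .circOp, .circOp))) := by
  have h : (Finset.univ : Finset GDGen) = {.br, .circ, .circOp} := by decide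
  simp only [Fintype.sum_prod_type, h]
  simp [add_assoc]

theorem pair_term (r : O3 k) (p q : GDGen) (a b c : Fin 3) :
    ∑ i, r i * term k p q a b c i = if b = a + 1 then r (c, p, q) else
      match q with
      | .br => - r (c, p, .br)
      | .circ => r (c, p, .circOp)
      | .circOp => r (c, p, .circ) := by
  unfold term
  split
  · simp [Pi.single_apply]
  · cases q <;> simp [Pi.single_apply]


/-- The defining identities of `GD^!`-algebras: `∗` is associative and commutative, `⋆` is a
right Novikov product, and two identities connect them. -/
structure GDDualIdentities (m : Ops k GDDualOp A) : Prop where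
  ast_comm : ∀ x y, m .ast x y = m .ast y x
  ast_assoc : ∀ x y z, m .ast x (m .ast y z) = m .ast (m .ast x y) z
  star_rsymm : ∀ x y z, m .star (m .star x y) z - m .star x (m .star y z) =
    m .star (m .star x z) y - m .star x (m .star z y)
  star_lcomm : ∀ x y z, m .star x (m .star y z) = m .star y (m .star x z)
  star_ast : ∀ x y z, m .star x (m .ast y z) = m .ast (m .star x y) z
  ast_star : ∀ x y z, m .star x (m .ast y z) + m .star y (m .ast x z) = m .star (m .ast x y) z

theorem perm_cases (s : Equiv.Perm (Fin 3)) :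
    (s 0 = 0 ∧ s 1 = 1 ∧ s 2 = 2) ∨ (s 0 = 0 ∧ s 1 = 2 ∧ s 2 = 1) ∨
    (s 0 = 1 ∧ s 1 = 0 ∧ s 2 = 2) ∨ (s 0 = 1 ∧ s 1 = 2 ∧ s 2 = 0) ∨
    (s 0 = 2 ∧ s 1 = 0 ∧ s 2 = 1) ∨ (s 0 = 2 ∧ s 1 = 1 ∧ s 2 = 0) := by
  revert s; decide

theorem pair_eq_zero (r : O3 k)
    (J : r (0, .br, .br) + r (1, .br, .br) + r (2, .br, .br) = 0)
    (R0 : r (0, .circ, .circ) = r (2, .circ, .circOp))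
    (R1 : r (1, .circ, .circ) = r (0, .circ, .circOp))
    (R2 : r (2, .circ, .circ) = r (1, .circ, .circOp))
    (L0 : r (1, .circ, .circOp) - r (0, .circOp, .circ) - r (2, .circ, .circOp)
      + r (1, .circOp, .circOp) = 0)
    (L1 : r (2, .circ, .circOp) - r (1, .circOp, .circ) - r (0, .circ, .circOp)
      + r (2, .circOp, .circOp) = 0)
    (L2 : r (0, .circ, .circOp) - r (2, .circOp, .circ) - r (1, .circ, .circOp)
      + r (0, .circOp, .circOp) = 0)
    (C0 : r (2, .br, .circ) - r (1, .br, .circOp) + r (2, .circ, .br) + r (1, .circ, .br)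
      - r (0, .circOp, .br) = 0)
    (C1 : r (0, .br, .circ) - r (2, .br, .circOp) + r (0, .circ, .br) + r (2, .circ, .br)
      - r (1, .circOp, .br) = 0)
    (C2 : r (1, .br, .circ) - r (0, .br, .circOp) + r (1, .circ, .br) + r (0, .circ, .br)
      - r (2, .circOp, .br) = 0) (g : O3 k) (hg : GDRel k g) : ∑ i, r i * g i = 0 := by
  rcases hg with s | s | s | s
  all_goals
    simp only [Pi.add_apply, Pi.sub_apply, Pi.neg_apply, mul_add, mul_sub, mul_neg,
      Finset.sum_add_distrib, Finset.sum_sub_distrib, Finset.sum_neg_distrib, pair_term]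
    rcases perm_cases s with ⟨h0, h1, h2⟩ | ⟨h0, h1, h2⟩ | ⟨h0, h1, h2⟩ | ⟨h0, h1, h2⟩ |
      ⟨h0, h1, h2⟩ | ⟨h0, h1, h2⟩ <;> simp [h0, h1, h2] <;> grind

/-- The Koszul dual of GD in explicit form: `GD^!`-algebras are defined by the identities
`GDDualIdentities`. -/
theorem isGDDual_iff (m : Ops k GDDualOp A) : IsGDDual m ↔ GDDualIdentities m := by
  constructor
  · rintro ⟨hc, h⟩
    have key : ∀ r : O3 k, (∀ g : O3 k, GDRel k g → ∑ i, r i * g i = 0) → ∀ x y z : A,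
        ∑ i, r i • dualOp m i.2.1 (dualOp m i.2.2 (![x, y, z] (i.1 + 1)) (![x, y, z] (i.1 + 2)))
          (![x, y, z] i.1) = 0 := fun r hr x y z => h r hr ![x, y, z]
    have h1 := key (Pi.single (2, .br, .br) 1 - Pi.single (0, .br, .br) 1)
      (pair_eq_zero _ (by simp) (by simp) (by simp) (by simp) (by simp) (by simp) (by simp)
        (by simp) (by simp) (by simp))
    have h2 := key (Pi.single (2, .circ, .circ) 1 + Pi.single (0, .circOp, .circ) 1
        + Pi.single (1, .circ, .circOp) 1 + Pi.single (0, .circOp, .circOp) 1)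
      (pair_eq_zero _ (by simp) (by simp) (by simp) (by simp) (by simp) (by simp) (by simp)
        (by simp) (by simp) (by simp))
    have h3 := key (Pi.single (0, .circOp, .circ) 1 + Pi.single (1, .circOp, .circOp) 1)
      (pair_eq_zero _ (by simp) (by simp) (by simp) (by simp) (by simp) (by simp) (by simp)
        (by simp) (by simp) (by simp))
    have h4 := key (Pi.single (0, .circOp, .br) 1 + Pi.single (2, .br, .circ) 1)
      (pair_eq_zero _ (by simp) (by simp) (by simp) (by simp) (by simp) (by simp) (by simp)
        (by simp) (by simp) (by simp))
    have h5 := key (Pi.single (0, .circOp, .br) 1 + Pi.single (1, .circOp, .br) 1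
        + Pi.single (2, .circ, .br) 1)
      (pair_eq_zero _ (by simp) (by simp) (by simp) (by simp) (by simp) (by simp) (by simp)
        (by simp) (by simp) (by simp))
    clear key h
    simp [add_smul, sub_smul, Finset.sum_add_distrib, Pi.single_apply, ite_smul, dualOp]
      at h1 h2 h3 h4 h5
    refine ⟨hc, fun x y z => ?_, fun x y z => ?_, fun x y z => ?_, fun x y z => ?_,
      fun x y z => ?_⟩
    · rw [hc x, ← sub_eq_zero, ← neg_eq_zero, ← h1 x y z]; abel
    · rw [← sub_eq_zero, ← h2 x y z]; abel
    · rw [eq_comm, ← sub_eq_zero, ← h3 x y z]; abel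
    · rw [eq_comm, ← sub_eq_zero, ← h4 x y z]; abel
    · rw [hc x z, eq_comm, ← sub_eq_zero, ← h5 x y z]; abel
  · rintro ⟨c, as, rs, lc, sa, ss⟩
    refine ⟨c, fun r hr x => ?_⟩
    have J := hr _ (.jacobi 1)
    have L (s) := hr _ (.lsymm s)
    have R (s) := hr _ (.rcomm s)
    have C (s) := hr _ (.compat s)
    simp only [Pi.add_apply, Pi.sub_apply, Pi.neg_apply, mul_add, mul_sub, mul_neg,
      Finset.sum_add_distrib, Finset.sum_sub_distrib, Finset.sum_neg_distrib, pair_term]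
      at J L R C
    have L1 := L 1
    have L5 := L (Equiv.swap 0 1 * Equiv.swap 1 2)
    have L6 := L (Equiv.swap 1 2 * Equiv.swap 0 1)
    have R1 := R 1
    have R5 := R (Equiv.swap 0 1 * Equiv.swap 1 2)
    have R6 := R (Equiv.swap 1 2 * Equiv.swap 0 1)
    have C2 := C (Equiv.swap 0 1)
    have C3 := C (Equiv.swap 0 2)
    have C4 := C (Equiv.swap 1 2)
    clear L R C hr
    simp [Equiv.swap_apply_def] at J L1 L5 L6 R1 R5 R6 C2 C3 C4
    rw [sum_O3, Fin.sum_univ_three]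
    simp [dualOp]
    generalize x 0 = a, x 1 = b, x 2 = d
    have e1 : m .ast (m .ast b d) a = m .ast (m .ast a b) d := by rw [c, as]
    have e2 : m .ast (m .ast d a) b = m .ast (m .ast a b) d := by rw [c d a, ← as, c d b, as]
    have q (x y z : A) : m .ast (m .star x y) z = m .ast (m .star x z) y := by
      rw [← sa, c y z, sa]
    simp only [e1, e2, ← ss, sa]
    rw [q a d b, q b d a, q d b a]
    have f1 : m .star (m .star b a) d = m .star (m .star b d) a - m .star b (m .star d a)
      + m .star b (m .star a d) := by rw [← rs b a d]; abel
    have f2 : m .star (m .star d b) a = m .star (m .star d a) b - m .star d (m .star a b)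
      + m .star d (m .star b a) := by rw [← rs d b a]; abel
    have f3 : m .star (m .star a d) b = m .star (m .star a b) d - m .star a (m .star b d)
      + m .star a (m .star d b) := by rw [← rs a d b]; abel
    rw [f1, f2, f3, lc b a d, lc d b a, lc a d b]
    linear_combination (norm := module) J • m .ast (m .ast a b) d + C2 • m .ast (m .star a b) d
      + C3 • m .ast (m .star b a) d + C4 • m .ast (m .star d a) b
      + R1 • m .star (m .star a b) d + R5 • m .star (m .star b d) a
      + R6 • m .star (m .star d a) b + (L1 - R1) • m .star a (m .star b d)
      + (L5 - R5) • m .star b (m .star d a) + (L6 - R6) • m .star d (m .star a b)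

end GDDual

/-- The class of `GD^!`-algebras over `k`. -/
def GDDual (k : Type u) [Field k] : AlgClass.{u, 0, u} k GDDualOp :=
  fun _A _ _ m => IsGDDual m

/-! ## Differential algebras and generalized derived identities -/

/-- The symbols `≺`, `≻`, `·`. -/
inductive DOp where
  | prec : DOp
  | succ : DOp
  | dot : DOp

section Derived

variable {k : Type*} [Field k] {ι : Type*} {A : Type*} [AddCommGroup A] [Module k A]

/-- `d` is a derivation of the algebra `(A, m)`. -/
def IsDerivation (m : Ops k ι A) (d : A →ₗ[k] A) : Prop :=
  ∀ i a b, d (m i a b) = m i (d a) b + m i a (d b)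

/-- The system `A^{(d*)}`: for every operation `ab` of `A`, the operations `a ≺ b = a d(b)`,
`a ≻ b = d(a) b`, and `a · b = ab`. -/
def derivedOps (m : Ops k ι A) (d : A →ₗ[k] A) : Ops k (ι × DOp) A
  | (i, .prec) => (m i).compl₂ d
  | (i, .succ) => (m i).comp d
  | (i, .dot) => m i

end Derived

/-- `f` is a generalized derived identity of the class `V`. -/
def IsGenDerivedIdentity {k : Type u} [Field k] {ι : Type v} (V : AlgClass.{u, v, w} k ι) {n : ℕ}
    (f : MPoly k (ι × DOp) n) : Prop :=
  ∀ (A : Type w) [AddCommGroup A] [Module k A] (m : Ops k ι A), V A m →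
    ∀ d : A →ₗ[k] A, IsDerivation m d → Holds (derivedOps m d) f

/-! ## The Manin white product `V ∘ GD^!` -/

/-- The first factor of a monomial in `≺`, `≻`, `·`: all three are replaced by the
multiplication. -/
def Mon.fst {ι α : Type*} : Mon (ι × DOp) α → Mon ι α
  | .var a => .var a
  | .op o s t => .op o.1 s.fst t.fst

/-- The second factor of a monomial in `≺`, `≻`, `·`: a product `f ≻ g` becomes `f ⋆ g`,
a product `f ≺ g` becomes `g ⋆ f`, and a product `f · g` becomes `f ∗ g`. -/
def Mon.snd {ι α : Type*} : Mon (ι × DOp) α → Mon GDDualOp α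
  | .var a => .var a
  | .op (_, .prec) s t => .op .star t.snd s.snd
  | .op (_, .succ) s t => .op .star s.snd t.snd
  | .op (_, .dot) s t => .op .ast s.snd t.snd

theorem Mon.occ_fst {ι α : Type*} [DecidableEq α] (a : α) (t : Mon (ι × DOp) α) :
    t.fst.occ a = t.occ a := by
  induction t with
  | var b => rfl
  | op o s t hs ht => simp [Mon.fst, Mon.occ, hs, ht]

theorem Mon.occ_snd {ι α : Type*} [DecidableEq α] (a : α) (t : Mon (ι × DOp) α) :
    t.snd.occ a = t.occ a := by
  induction t with
  | var b => rfl
  | op o s t hs ht =>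
    obtain ⟨i, o | o | o⟩ := o <;> simp [Mon.snd, Mon.occ, hs, ht, add_comm]

/-- The first factor of a multilinear monomial. -/
def MultMon.fst {ι : Type*} {n : ℕ} (t : MultMon (ι × DOp) n) : MultMon ι n :=
  ⟨Mon.fst t.1, fun i => by rw [Mon.occ_fst, t.2 i]⟩

/-- The second factor of a multilinear monomial. -/
def MultMon.snd {ι : Type*} {n : ℕ} (t : MultMon (ι × DOp) n) : MultMon GDDualOp n :=
  ⟨Mon.snd t.1, fun i => by rw [Mon.occ_snd, t.2 i]⟩

/-- The linear map from the multilinear polynomials in `≺`, `≻`, `·` to the Hadamard product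
`V(n) ⊗ GD^!(n)` that computes the compositions componentwise, where
* `x₁ ≻ x₂ = x₁ x₂ ⊗ x₁ ⋆ x₂`,
* `x₁ ≺ x₂ = x₁ x₂ ⊗ x₂ ⋆ x₁`,
* `x₁ · x₂ = x₁ x₂ ⊗ x₁ ∗ x₂`.

These elements and their transposes span `V(2) ⊗ GD^!(2)`, so the range is the component
`(V ∘ GD^!)(n)` of the sub-operad generated by `V(2) ⊗ GD^!(2)`. -/
noncomputable def whiteMap {k : Type u} [Field k] {ι : Type v} (V : AlgClass.{u, v, w} k ι)
    (n : ℕ) :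
    MPoly k (ι × DOp) n →ₗ[k] OperadComp V n ⊗[k] OperadComp (GDDual k) n :=
  Finsupp.linearCombination k fun t : MultMon (ι × DOp) n =>
    (identities V n).mkQ (Finsupp.single (MultMon.fst t) 1) ⊗ₜ[k]
      (identities (GDDual k) n).mkQ (Finsupp.single (MultMon.snd t) 1)

/-- `(V ∘ GD^!)`-algebras: algebras over the sub-operad `V ∘ GD^!` of the Hadamard product,
written in terms of the generators `≺`, `≻`, `·`. A polynomial is an identity of all of them as
soon as it vanishes in `(V ∘ GD^!)(n) ⊆ V(n) ⊗ GD^!(n)`. -/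
def IsWhiteAlgebra {k : Type u} [Field k] {ι : Type v} (V : AlgClass.{u, v, w} k ι)
    {B : Type*} [AddCommGroup B] [Module k B] (m : Ops k (ι × DOp) B) : Prop :=
  ∀ (n : ℕ) (g : MPoly k (ι × DOp) n), whiteMap V n g = 0 → Holds m g

end GDWhite

/-! The core is that free `GD^!`-algebras embed into differential polynomials: a multilinear
polynomial in ∗, ⋆ that vanishes under x ∗ y = xy, x ⋆ y = x'y is an identity of all `GD^!`-algebras
(`ker_diffEval_le_identities`). Given this, tensor an algebra A of the variety with the differential
polynomials R. The result stays in the variety (`holds_tensorOps`) and has the derivation id ⊗ ∂, so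
a generalized derived identity vanishes at the elements x_i ⊗ X_i, where the two tensor factors of
each monomial separate. Contraction with functionals on R gives a zero element of Var(n) ⊗ R
(`sum_tmul_diffEval_eq_zero`), and the embedding carries it to the image of the identity in Var(n) ⊗
GD^!(n).

For the embedding, differential monomials must be evaluated in any `GD^!`-algebra. A derivative
x^(j), j ≥ 1, becomes the j-ary operation modelled on x^(j) a_1 ⋯ a_j: x' sends a to x ⋆ a, and
x^(j+1)(b, a_1, …, a_j) is x^(j)(a_1, …, a_j) ⋆ b minus the sum of all x^(j)(…, a_i ⋆ b, …). Right
symmetry makes these operations symmetric (`permInv_derOp`); the other identities make them commute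
with each other and with ∗ (`OpSym.commOp_fn`). A monomial whose order is less than its length is
evaluated by composing its derivatives with enough copies of ∗ and inserting its undifferentiated
variables; the order of the factors is immaterial (`normalValue_perm`). As ∗ has zero derivative
(`lieD_astOp`), a Leibniz rule shows that these values multiply as differential monomials do
(`normalValue_ast`, `normalValue_star`). -/

namespace GDWhite

/-! ### Symmetric and commuting operations. -/

section ListFunctions

variable {A : Type*}

/-- A function of lists does not depend on the order of the entries. -/
def PermInv (F : List A → A) : Prop :=
  ∀ l l', l.Perm l' → F l = F l'

/-- Two symmetric operations commute as elements of the commutative algebra of operations. -/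
def CommOp (F G : List A → A) : Prop :=
  ∀ a U Z, F (G (a :: U) :: Z) = G (F (a :: Z) :: U)

theorem CommOp.symm {F G : List A → A} (h : CommOp F G) : CommOp G F :=
  fun a U Z => (h a Z U).symm

theorem PermInv.cons {F : List A → A} (h : PermInv F) (z : A) : PermInv fun l => F (z :: l) :=
  fun _ _ p => h _ _ (p.cons z)

theorem permInv_of_swap {F : List A → A}
    (h : ∀ p a b q, F (p ++ a :: b :: q) = F (p ++ b :: a :: q)) : PermInv F := by
  intro l l' p
  induction p generalizing F with
  | nil => rfl
  | cons x _ ih => exact ih (F := fun l => F (x :: l)) fun p => h (x :: p)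
  | swap x y l => exact h [] y x l
  | trans _ _ ih ih' => rw [ih h, ih' h]

/-- Symmetry of `F` extends commutation from its first slot to every slot. -/
theorem PermInv.comm {F G : List A → A} (hF : PermInv F) (h : CommOp F G) (p : List A) (z : A)
    (q U : List A) : F (p ++ G (z :: U) :: q) = G (F (p ++ z :: q) :: U) := by
  rw [hF _ _ List.perm_middle, h, hF _ _ List.perm_middle]

end ListFunctions

/-! ### Derivatives as operations of a `GD^!`-algebra. -/

section ListOperations

variable {k : Type*} [Field k] {A : Type*} [AddCommGroup A] [Module k A]

/-- A function of lists is additive in each entry of the list. -/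
def MultiAdd (F : List A → A) : Prop :=
  ∀ p a b q, F (p ++ (a + b) :: q) = F (p ++ a :: q) + F (p ++ b :: q)

/-- The Lie derivative of an operation `F` along `a ↦ a ⋆ b`. -/
def lieD (m : Ops k GDDualOp A) (b : A) : List A → (List A → A) → A
  | [], F => m .star (F []) b
  | z :: l, F => lieD m b l (fun l => F (z :: l)) - F (m .star z b :: l)

/-- The derivative of an operation; the direction is the first argument. -/
def der (m : Ops k GDDualOp A) (F : List A → A) : List A → A
  | [] => 0
  | b :: l => lieD m b l F

theorem MultiAdd.cons {F : List A → A} (h : MultiAdd F) (z : A) :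
    MultiAdd fun l => F (z :: l) :=
  fun p => h (z :: p)

theorem map_sub_head {F : List A → A}
    (h : ∀ a b q, F ((a + b) :: q) = F (a :: q) + F (b :: q)) (a b : A) (q : List A) :
    F ((a - b) :: q) = F (a :: q) - F (b :: q) := by
  rw [eq_sub_iff_add_eq, ← h, sub_add_cancel]

theorem map_zero_head {F : List A → A}
    (h : ∀ a b q, F ((a + b) :: q) = F (a :: q) + F (b :: q)) (q : List A) :
    F (0 :: q) = 0 := by
  simpa using map_sub_head h 0 0 q

theorem MultiAdd.head {F : List A → A} (h : MultiAdd F) (a b : A) (q : List A) :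
    F ((a + b) :: q) = F (a :: q) + F (b :: q) :=
  h [] a b q

variable (m : Ops k GDDualOp A)

theorem lieD_zero (b : A) (l : List A) : lieD m b l (fun _ => 0) = 0 := by
  induction l with
  | nil => simp [lieD]
  | cons z l ih => simp [lieD, ih]

theorem lieD_add (b : A) (l : List A) (F G : List A → A) :
    lieD m b l (fun l => F l + G l) = lieD m b l F + lieD m b l G := by
  induction l generalizing F G with
  | nil => simp [lieD]
  | cons z l ih => simp only [lieD, ih]; abel

theorem lieD_sub (b : A) (l : List A) (F G : List A → A) :
    lieD m b l (fun l => F l - G l) = lieD m b l F - lieD m b l G := by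
  rw [eq_sub_iff_add_eq, ← lieD_add]; simp

theorem lieD_dir_add {F : List A → A} (h : MultiAdd F) (b c : A) (l : List A) :
    lieD m (b + c) l F = lieD m b l F + lieD m c l F := by
  induction l generalizing F with
  | nil => simp [lieD]
  | cons z l ih => simp only [lieD, ih (h.cons z), map_add, h.head]; abel

theorem multiAdd_lieD {F : List A → A} (h : MultiAdd F) (c : A) :
    MultiAdd fun l => lieD m c l F := by
  intro p a b q
  induction p generalizing F with
  | nil =>
    simp only [List.nil_append, lieD, map_add, LinearMap.add_apply, h.head, lieD_add]
    abel
  | cons z p ih =>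
    have h1 := ih (h.cons z)
    have h2 := h (m .star z c :: p) a b q
    simp only [List.cons_append, lieD] at h1 h2 ⊢
    rw [h1, h2]; abel

theorem multiAdd_der {F : List A → A} (h : MultiAdd F) : MultiAdd (der m F) := by
  intro p a b q
  cases p with
  | nil => exact lieD_dir_add m h a b q
  | cons z p => exact multiAdd_lieD m h z p a b q

theorem permInv_lieD {F : List A → A} (h : PermInv F) (b : A) :
    PermInv fun l => lieD m b l F := by
  intro l l' p
  induction p generalizing F with
  | nil => rfl
  | cons x p ih =>
    have := ih (h.cons x)
    simp only [lieD] at this ⊢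
    rw [this, h _ _ (p.cons _)]
  | swap x y l =>
    simp only [lieD]
    have e (u v : A) : F (u :: v :: l) = F (v :: u :: l) := h _ _ (List.Perm.swap _ _ _)
    have e' : (fun l => F (y :: x :: l)) = fun l => F (x :: y :: l) :=
      funext fun l => h _ _ (List.Perm.swap _ _ _)
    rw [e', e, e x]; abel
  | trans _ _ ih ih' => exact (ih h).trans (ih' h)

variable {m}

/-- Terms in which `y` and `z` act at different places are symmetric in pairs; where both act on the
same entry, or on the value of `F`, right symmetry of ⋆ applies. -/
theorem lieD_lieD (hm : GDDualIdentities m) {F : List A → A} (h : MultiAdd F) (y z : A)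
    (l : List A) :
    lieD m y l (fun l => lieD m z l F) - lieD m (m .star z y) l F =
      lieD m z l (fun l => lieD m y l F) - lieD m (m .star y z) l F := by
  induction l generalizing F with
  | nil =>
    simp only [lieD]
    exact (hm.star_rsymm _ _ _)
  | cons u l ih =>
    have h1 := ih (h.cons u)
    have h2 := hm.star_rsymm u y z
    rw [sub_eq_sub_iff_add_eq_add] at h2
    have h3 := congrArg (fun a => F (a :: l)) h2
    simp only [h.head] at h3
    simp only [lieD, lieD_sub]
    rw [sub_eq_sub_iff_add_eq_add] at h1 ⊢
    linear_combination (norm := abel) h1 + h3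

/-- Exchanging the two directions is `lieD_lieD`; permuting everything after the first entry is the
symmetry of `der m F`. -/
theorem permInv_der_der (hm : GDDualIdentities m) {F : List A → A} (h : MultiAdd F)
    (hF : PermInv (der m F)) : PermInv (der m (der m F)) := by
  intro l l' p
  induction p with
  | nil => rfl
  | cons x p _ => exact permInv_lieD m hF x _ _ p
  | swap y z l => exact lieD_lieD hm h z y l
  | trans _ _ ih ih' => exact ih.trans ih'

/-- In each term `G` first slides out of ⋆, then out of the slot of `F` that contains it. -/
theorem lieD_comm {F G : List A → A} (hG : MultiAdd G) {U : List A}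
    (hs : ∀ a z, m .star z (G (a :: U)) = G (m .star z a :: U))
    (h : ∀ p z q, F (p ++ G (z :: U) :: q) = G (F (p ++ z :: q) :: U)) (a : A) (Z : List A) :
    lieD m (G (a :: U)) Z F = G (lieD m a Z F :: U) := by
  induction Z generalizing F with
  | nil => exact hs _ _
  | cons z Z ih =>
    have h1 := h [] (m .star z a) Z
    simp only [List.nil_append] at h1
    simp only [lieD]
    rw [ih fun p => h (z :: p), hs, h1, map_sub_head hG.head]

/-- An element as an operation without arguments. -/
def pointOp (x : A) : List A → A
  | [] => x
  | _ :: _ => 0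

variable (m) in
/-- The operation that stands for the `j`-th derivative of `x`. -/
def derOp (x : A) (j : ℕ) : List A → A := (der m)^[j] (pointOp x)

theorem derOp_succ (x : A) (j : ℕ) : derOp m x (j + 1) = der m (derOp m x j) :=
  Function.iterate_succ_apply' _ _ _

theorem derOp_one_singleton (x a : A) : derOp m x 1 [a] = m .star x a := rfl

theorem derOp_one_cons_cons (x a b : A) (l : List A) : derOp m x 1 (a :: b :: l) = 0 := by
  rw [derOp_succ]
  simp only [der, lieD, derOp, pointOp, Function.iterate_zero, id]
  simp [lieD_zero]

theorem multiAdd_derOp (x : A) (j : ℕ) : MultiAdd (derOp m x j) := by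
  induction j with
  | zero =>
    intro p a b q
    cases p <;> simp [derOp, pointOp]
  | succ j ih => rw [derOp_succ]; exact multiAdd_der m ih

theorem permInv_derOp (hm : GDDualIdentities m) (x : A) (j : ℕ) : PermInv (derOp m x j) := by
  -- `permInv_der_der` needs symmetry of the first derivative, so orders 0 and 1 are both base
  -- cases; there the operations vanish on lists with two or more entries.
  induction j using Nat.twoStepInduction with
  | zero =>
    refine permInv_of_swap fun p a b q => ?_
    cases p <;> rfl
  | one =>
    refine permInv_of_swap fun p a b q => ?_
    rcases p with _ | ⟨z, _ | ⟨y, p⟩⟩ <;> simp [derOp_one_cons_cons]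
  | more j _ ih =>
    rw [derOp_succ] at ih
    rw [derOp_succ, derOp_succ]
    exact permInv_der_der hm (multiAdd_derOp x j) ih

variable (m) in
/-- The operation `∗` as a function of lists. -/
def astOp : List A → A
  | [a, b] => m .ast a b
  | _ => 0

theorem multiAdd_astOp : MultiAdd (astOp m) := by
  intro p a b q
  rcases p with _ | ⟨z, _ | ⟨y, p⟩⟩ <;> rcases q with _ | ⟨z', _ | ⟨y', q⟩⟩ <;> simp [astOp]

theorem permInv_astOp (hm : GDDualIdentities m) : PermInv (astOp m) := by
  refine permInv_of_swap fun p a b q => ?_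
  rcases p with _ | ⟨z, _ | ⟨y, p⟩⟩ <;> rcases q with _ | ⟨z', _ | ⟨y', q⟩⟩ <;>
    simp [astOp, hm.ast_comm a b]

/-- On two entries this is (yz)'b = y'bz + yz'b; on other lengths every term is zero. -/
theorem lieD_astOp (hm : GDDualIdentities m) (b : A) (l : List A) : lieD m b l (astOp m) = 0 := by
  rcases l with _ | ⟨y, _ | ⟨z, _ | ⟨u, l⟩⟩⟩
  · simp [lieD, astOp]
  · simp [lieD, astOp]
  · simp only [lieD, astOp]
    rw [← hm.ast_star, hm.ast_comm z b, hm.star_ast, hm.ast_comm y b, hm.star_ast,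
      hm.ast_comm y]
    abel
  · simp [lieD, astOp, lieD_zero]

/-- Symbols of operations: `none` for `∗`, and `some (x, j)` for the derivative of `x` of order
`j + 1`. -/
abbrev OpSym (A : Type*) := Option (A × ℕ)

variable (m) in
/-- The operation denoted by a symbol. -/
def OpSym.fn : OpSym A → List A → A
  | none => astOp m
  | some (x, j) => derOp m x (j + 1)

/-- The arity of a symbol, minus one. -/
def OpSym.wt : OpSym A → ℕ
  | none => 1
  | some (_, j) => j

theorem OpSym.multiAdd_fn (F : OpSym A) : MultiAdd (F.fn m) := by
  rcases F with _ | ⟨x, j⟩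
  · exact multiAdd_astOp
  · exact multiAdd_derOp x _

theorem OpSym.permInv_fn (hm : GDDualIdentities m) (F : OpSym A) : PermInv (F.fn m) := by
  rcases F with _ | ⟨x, j⟩
  · exact permInv_astOp hm
  · exact permInv_derOp hm x _

theorem commOp_derOp (hm : GDDualIdentities m) {G : List A → A} (hG : MultiAdd G)
    (h : ∀ z, CommOp (derOp m z 1) G) (x : A) (j : ℕ) : CommOp (derOp m x (j + 1)) G := by
  induction j with
  | zero => exact h x
  | succ j ih =>
    intro a U Z
    rw [derOp_succ]
    exact lieD_comm hG (fun a z => h z a U []) (fun p z q => (permInv_derOp hm _ _).comm ih p z q U)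
      a Z

theorem commOp_derOp_one_one (hm : GDDualIdentities m) (x y : A) :
    CommOp (derOp m x 1) (derOp m y 1) := by
  intro a U Z
  rcases U with _ | ⟨u, U⟩ <;> rcases Z with _ | ⟨z, Z⟩ <;>
    simp only [derOp_one_singleton, derOp_one_cons_cons, map_zero]
  exact hm.star_lcomm _ _ _

theorem commOp_derOp_one_ast (hm : GDDualIdentities m) (x : A) :
    CommOp (derOp m x 1) (astOp m) := by
  intro a U Z
  rcases Z with _ | ⟨z, Z⟩
  · rcases U with _ | ⟨u, _ | ⟨v, U⟩⟩ <;> simp [derOp_one_singleton, astOp, hm.star_ast]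
  · rw [derOp_one_cons_cons, derOp_one_cons_cons, map_zero_head multiAdd_astOp.head]

theorem commOp_ast_ast (hm : GDDualIdentities m) : CommOp (astOp m) (astOp m) := by
  intro a U Z
  rcases U with _ | ⟨u, _ | ⟨v, U⟩⟩ <;> rcases Z with _ | ⟨z, _ | ⟨y, Z⟩⟩ <;> simp [astOp]
  rw [← hm.ast_assoc, hm.ast_comm u, hm.ast_assoc]

theorem OpSym.commOp_fn (hm : GDDualIdentities m) (F G : OpSym A) :
    CommOp (F.fn m) (G.fn m) := by
  -- Commutation with first derivatives comes first: it is the hypothesis needed to raise the order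
  -- of the other operation.
  have h1 (F : OpSym A) (z : A) : CommOp (derOp m z 1) (F.fn m) := by
    rcases F with _ | ⟨x, j⟩
    · exact commOp_derOp_one_ast hm z
    · exact (commOp_derOp hm (multiAdd_derOp z 1) (fun y => commOp_derOp_one_one hm y z) x j).symm
  have h2 (x : A) (j : ℕ) (G : OpSym A) : CommOp (derOp m x (j + 1)) (G.fn m) :=
    commOp_derOp hm G.multiAdd_fn (h1 G) x j
  rcases F with _ | ⟨x, j⟩
  · rcases G with _ | ⟨y, i⟩
    · exact commOp_ast_ast hm
    · exact (h2 y i none).symm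
  · exact h2 x j G

/-! ### Compositions of commuting operations. -/

variable (m) in
/-- Composition of a list of operations, applied to a list of arguments: every operation
consumes the entries at the beginning of the list and puts its value there. -/
def comp : List (OpSym A) → List A → A
  | [], [u] => u
  | [], _ => 0
  | F :: Fs, U => comp Fs (F.fn m (U.take (F.wt + 1)) :: U.drop (F.wt + 1))

theorem comp_cons_append (F : OpSym A) (Fs : List (OpSym A)) {X : List A}
    (hX : X.length = F.wt + 1) (Z : List A) :
    comp m (F :: Fs) (X ++ Z) = comp m Fs (F.fn m X :: Z) := by
  rw [comp, ← hX, List.take_left, List.drop_left]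

theorem comp_add_head (Fs : List (OpSym A)) (a b : A) (U : List A) :
    comp m Fs ((a + b) :: U) = comp m Fs (a :: U) + comp m Fs (b :: U) := by
  induction Fs generalizing a b U with
  | nil => cases U <;> simp [comp]
  | cons F Fs ih => simp only [comp, List.take_succ_cons, List.drop_succ_cons,
      F.multiAdd_fn.head, ih]

theorem comp_pull (hm : GDDualIdentities m) (G : OpSym A) (Fs : List (OpSym A)) (a : A)
    (W U : List A) :
    comp m Fs (G.fn m (a :: W) :: U) = G.fn m (comp m Fs (a :: U) :: W) := by
  induction Fs generalizing a U with
  | nil =>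
    cases U
    · simp [comp]
    · simp [comp, map_zero_head G.multiAdd_fn.head]
  | cons F Fs ih =>
    simp only [comp, List.take_succ_cons, List.drop_succ_cons]
    rw [F.commOp_fn hm G, ih]

theorem permInv_comp (hm : GDDualIdentities m) (Fs : List (OpSym A)) : PermInv (comp m Fs) := by
  induction Fs with
  | nil =>
    refine permInv_of_swap fun p a b q => ?_
    rcases p with _ | ⟨z, _ | ⟨y, p⟩⟩ <;> simp [comp]
  | cons F Fs ih =>
    refine permInv_of_swap fun p a b q => ?_
    rcases lt_trichotomy p.length F.wt with h | h | h
    · obtain ⟨r, hr⟩ := Nat.exists_eq_add_of_lt h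
      have e (a b : A) : comp m (F :: Fs) (p ++ a :: b :: q)
          = comp m Fs (F.fn m (p ++ a :: b :: q.take r) :: q.drop r) := by
        rw [comp]
        have e1 : F.wt + 1 = p.length + (r + 2) := by omega
        rw [e1, List.take_length_add_append, List.drop_length_add_append]
        rfl
      rw [e, e, F.permInv_fn hm _ _ ((List.Perm.swap b a _).append_left p)]
    -- Here `a` is the last argument of `F` and `b` the first entry beyond. Pulling `F` outside
    -- makes both arguments of the remaining composition.
    · have e (a b : A) : comp m (F :: Fs) (p ++ a :: b :: q)
          = F.fn m (comp m Fs (a :: b :: q) :: p) := by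
        rw [← comp_pull hm, List.append_cons, comp_cons_append _ _ (by simp [h]),
          F.permInv_fn hm _ _ (List.perm_append_singleton _ _)]
      rw [e, e, ih _ _ (List.Perm.swap b a q)]
    · have e (a b : A) : comp m (F :: Fs) (p ++ a :: b :: q) = comp m Fs
          (F.fn m (p.take (F.wt + 1)) :: (p.drop (F.wt + 1) ++ a :: b :: q)) := by
        rw [comp, List.take_append_of_le_length h, List.drop_append_of_le_length h]
      rw [e, e]
      exact ih _ _ (((List.Perm.swap b a q).append_left _).cons _)

/-- The weight of a list of operations: the arity of the composition, minus one. -/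
def wtSum (Fs : List (OpSym A)) : ℕ := (Fs.map OpSym.wt).sum

/-- The length bound gives both operations full argument lists. Commutation exchanges them, and
symmetry restores the order of the arguments. -/
theorem comp_swap (hm : GDDualIdentities m) (F G : OpSym A) (Fs : List (OpSym A)) (U : List A)
    (hU : F.wt + G.wt + 1 ≤ U.length) : comp m (F :: G :: Fs) U = comp m (G :: F :: Fs) U := by
  have key (F G : OpSym A) (a : A) (X Y Z : List A) (hX : X.length = F.wt)
      (hY : Y.length = G.wt) : comp m (F :: G :: Fs) (a :: (X ++ (Y ++ Z)))
        = comp m Fs (G.fn m (F.fn m (a :: X) :: Y) :: Z) := by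
    rw [← List.cons_append, comp_cons_append _ _ (by simp [hX]), ← List.cons_append,
      comp_cons_append _ _ (by simp [hY])]
  rcases U with _ | ⟨a, U⟩
  · simp at hU
  obtain ⟨X, Y, Z, hX, hY, rfl⟩ : ∃ X Y Z : List A, X.length = F.wt ∧ Y.length = G.wt ∧
      U = X ++ (Y ++ Z) := by
    simp only [List.length_cons] at hU
    refine ⟨U.take F.wt, (U.drop F.wt).take G.wt, (U.drop F.wt).drop G.wt, ?_, ?_, by simp⟩ <;>
      simp <;> omega
  rw [key F G a X Y Z hX hY, G.commOp_fn hm F, ← key G F a Y X Z hY hX]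
  refine permInv_comp hm _ _ _ (List.Perm.cons a ?_)
  rw [← List.append_assoc, ← List.append_assoc]
  exact List.perm_append_comm.append_right Z

theorem comp_perm (hm : GDDualIdentities m) {Fs Gs : List (OpSym A)} (p : Fs.Perm Gs)
    (U : List A) (hU : wtSum Fs + 1 ≤ U.length) : comp m Fs U = comp m Gs U := by
  induction p generalizing U with
  | nil => rfl
  | cons F p ih =>
    simp only [comp]
    simp only [wtSum, List.map_cons, List.sum_cons] at hU ih
    exact ih _ (by simp; omega)
  | swap F G Fs =>
    simp only [wtSum, List.map_cons, List.sum_cons] at hU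
    exact comp_swap hm _ _ _ _ (by omega)
  | trans p _ ih ih' =>
    rw [ih U hU, ih' U]
    rwa [wtSum, ← (p.map OpSym.wt).sum_eq]

theorem comp_append (Gs Fs : List (OpSym A)) (V U : List A) (hV : V.length = wtSum Gs + 1) :
    comp m (Gs ++ Fs) (V ++ U) = comp m Fs (comp m Gs V :: U) := by
  induction Gs generalizing V with
  | nil =>
    obtain ⟨a, rfl⟩ := List.length_eq_one_iff.1 hV
    rfl
  | cons G Gs ih =>
    simp only [wtSum, List.map_cons, List.sum_cons] at hV ih
    obtain ⟨X, Z, hX, rfl⟩ : ∃ X Z : List A, X.length = G.wt + 1 ∧ V = X ++ Z :=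
      ⟨V.take (G.wt + 1), V.drop (G.wt + 1), by simp; omega, by simp⟩
    rw [List.cons_append, List.append_assoc, comp_cons_append _ _ hX, comp_cons_append _ _ hX,
      ← List.cons_append]
    refine ih _ ?_
    simp at hV ⊢
    omega

/-- A unary operation touches only the head of the list, so no length bound is needed. -/
theorem comp_insert (hm : GDDualIdentities m) (u : A) (P Fs : List (OpSym A)) (b : A)
    (U : List A) :
    comp m (P ++ some (u, 0) :: Fs) (b :: U) = comp m (some (u, 0) :: (P ++ Fs)) (b :: U) := by
  induction P generalizing b U with
  | nil => rfl
  | cons F P ih =>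
    have h := fun U => OpSym.commOp_fn hm F (some (u, 0)) b [] U
    simp only [comp, List.cons_append, OpSym.wt, List.take_succ_cons, List.drop_succ_cons, ih,
      zero_add, List.take_zero, List.drop_zero, h]

end ListOperations

/-! ### Formal expansion into differential monomials. -/

section Sums

variable {α : Type*} {M : Type*} [AddCommMonoid M]

/-- The sum of `Q` over all lists obtained from a list of operations by differentiating one of
them. -/
def sumDerOps {A : Type*} : (List (OpSym A) → M) → List (OpSym A) → M
  | _, [] => 0
  | Q, none :: Fs => sumDerOps (fun Gs => Q (none :: Gs)) Fs
  | Q, some (x, j) :: Fs =>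
    Q (some (x, j + 1) :: Fs) + sumDerOps (fun Gs => Q (some (x, j) :: Gs)) Fs

/-- The sum of `Q` over all choices of an entry of a list. -/
def sumPick {A : Type*} : (A → List A → M) → List A → M
  | _, [] => 0
  | Q, u :: l => Q u l + sumPick (fun v l' => Q v (u :: l')) l

/-- The sum of `Q` over the terms of the derivative of a differential monomial, which is given
as a list of variables with orders of derivatives. -/
def sumDer : (List (α × ℕ) → M) → List (α × ℕ) → M
  | _, [] => 0
  | Q, (i, j) :: I => Q ((i, j + 1) :: I) + sumDer (fun J => Q ((i, j) :: J)) I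

/-- The order of a differential monomial. -/
def ord (I : List (α × ℕ)) : ℕ := (I.map Prod.snd).sum

theorem sumDer_congr {Q R : List (α × ℕ) → M} {I : List (α × ℕ)}
    (h : ∀ J, J.length = I.length → ord J = ord I + 1 → Q J = R J) :
    sumDer Q I = sumDer R I := by
  induction I generalizing Q R with
  | nil => rfl
  | cons i I ih =>
    simp only [ord, List.map_cons, List.sum_cons, List.length_cons] at h ih
    simp only [sumDer]
    congr 1
    · refine h _ (by simp) ?_
      simp; omega
    · refine ih fun J h1 h2 => h _ (by simp [h1]) ?_
      simp [h2]; omega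

theorem map_sumDer {N : Type*} [AddCommMonoid N] (φ : M →+ N) (Q : List (α × ℕ) → M)
    (I : List (α × ℕ)) : φ (sumDer Q I) = sumDer (fun J => φ (Q J)) I := by
  induction I generalizing Q with
  | nil => simp [sumDer]
  | cons i I ih => simp [sumDer, ih]

/-- The sum of `Q` over the differential monomials in the expansion of a monomial in `∗`, `⋆`,
where `x ∗ y = xy` and `x ⋆ y = x'y`. -/
def expandSum : Mon GDDualOp α → (List (α × ℕ) → M) → M
  | .var a, Q => Q [(a, 0)]
  | .op .ast s t, Q => expandSum s fun I => expandSum t fun J => Q (I ++ J)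
  | .op .star s t, Q =>
    expandSum s fun I => expandSum t fun J => sumDer (fun I' => Q (I' ++ J)) I

/-- Only monomials with length minus order at least 1 occur: this excess is additive under products,
and ⋆ lowers it by one from a total of at least 2. -/
theorem expandSum_congr {t : Mon GDDualOp α} {Q R : List (α × ℕ) → M}
    (h : ∀ I, ord I + 1 ≤ I.length → Q I = R I) : expandSum t Q = expandSum t R := by
  induction t generalizing Q R with
  | var a => exact h _ (by simp [ord])
  | op o s t hs ht =>
    cases o with
    | ast =>
      refine hs fun I hI => ht fun J hJ => h _ ?_
      simp [ord] at hI hJ ⊢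
      omega
    | star =>
      refine hs fun I hI => ht fun J hJ => sumDer_congr fun I' h1 h2 => h _ ?_
      simp [ord] at hI hJ h1 h2 ⊢
      omega

theorem map_expandSum {N : Type*} [AddCommMonoid N] (φ : M →+ N) (t : Mon GDDualOp α)
    (Q : List (α × ℕ) → M) : φ (expandSum t Q) = expandSum t fun I => φ (Q I) := by
  induction t generalizing Q with
  | var a => rfl
  | op o s t hs ht => cases o <;> simp only [expandSum, hs, ht, map_sumDer]

theorem bilin_expandSum {R M N P : Type*} [CommSemiring R] [AddCommMonoid M] [AddCommMonoid N]
    [AddCommMonoid P] [Module R M] [Module R N] [Module R P] (B : M →ₗ[R] N →ₗ[R] P)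
    (s t : Mon GDDualOp α) (Q : List (α × ℕ) → M) (Q' : List (α × ℕ) → N) :
    B (expandSum s Q) (expandSum t Q') =
      expandSum s fun I => expandSum t fun J => B (Q I) (Q' J) := by
  refine (map_expandSum (B.flip (expandSum t Q')).toAddMonoidHom s Q).trans ?_
  exact congrArg _ (funext fun I => map_expandSum (B (Q I)).toAddMonoidHom t Q')

variable {A : Type*} (x : α → A)

theorem wtSum_append (Fs Gs : List (OpSym A)) : wtSum (Fs ++ Gs) = wtSum Fs + wtSum Gs := by
  simp [wtSum]

theorem wtSum_replicate (e : ℕ) : wtSum (List.replicate e (none : OpSym A)) = e := by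
  simp [wtSum, OpSym.wt]

/-- The derivatives of positive order in a differential monomial. -/
def opsOf (I : List (α × ℕ)) : List (OpSym A) :=
  I.filterMap fun i => match i with
    | (_, 0) => none
    | (a, j + 1) => some (some (x a, j))

/-- The variables in a differential monomial that are not differentiated. -/
def argsOf (I : List (α × ℕ)) : List A :=
  I.filterMap fun i => match i with
    | (a, 0) => some (x a)
    | (_, _ + 1) => none

@[simp] theorem opsOf_zero (a : α) (I : List (α × ℕ)) : opsOf x ((a, 0) :: I) = opsOf x I := rfl

@[simp] theorem opsOf_succ (a : α) (j : ℕ) (I : List (α × ℕ)) :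
    opsOf x ((a, j + 1) :: I) = some (x a, j) :: opsOf x I := rfl

@[simp] theorem argsOf_zero (a : α) (I : List (α × ℕ)) :
    argsOf x ((a, 0) :: I) = x a :: argsOf x I := rfl

@[simp] theorem argsOf_succ (a : α) (j : ℕ) (I : List (α × ℕ)) :
    argsOf x ((a, j + 1) :: I) = argsOf x I := rfl

theorem opsOf_append (I J : List (α × ℕ)) : opsOf x (I ++ J) = opsOf x I ++ opsOf x J :=
  List.filterMap_append

theorem argsOf_append (I J : List (α × ℕ)) : argsOf x (I ++ J) = argsOf x I ++ argsOf x J :=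
  List.filterMap_append

theorem length_argsOf (I : List (α × ℕ)) :
    (argsOf x I).length + ord I = I.length + wtSum (opsOf x I) := by
  induction I with
  | nil => rfl
  | cons i I ih =>
    simp only [ord, wtSum] at ih
    rcases i with ⟨a, _ | j⟩ <;> simp [ord, wtSum, OpSym.wt] <;> omega

/-- The number of copies of ∗ is chosen so that the composition has exactly one input per
undifferentiated variable. -/
theorem length_argsOf_eq {I : List (α × ℕ)} (hI : ord I + 1 ≤ I.length) :
    (argsOf x I).length =
      wtSum (List.replicate (I.length - 1 - ord I) none ++ opsOf x I) + 1 := by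
  have := length_argsOf x I
  rw [wtSum_append, wtSum_replicate]
  omega

/-- A derivation either raises the order of a derivative or turns an argument `u` into the unary
operation u'; by `h` the position of u' is immaterial. -/
theorem sumDer_eq (Q : List (OpSym A) → List A → M)
    (h : ∀ u P Fs U, Q (P ++ some (u, 0) :: Fs) U = Q (some (u, 0) :: (P ++ Fs)) U)
    (I : List (α × ℕ)) :
    sumDerOps (fun Fs => Q Fs (argsOf x I)) (opsOf x I)
      + sumPick (fun u U => Q (some (u, 0) :: opsOf x I) U) (argsOf x I)
      = sumDer (fun J => Q (opsOf x J) (argsOf x J)) I := by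
  induction I generalizing Q with
  | nil => simp [sumDer, opsOf, argsOf, sumDerOps, sumPick]
  | cons i I ih =>
    rcases i with ⟨a, _ | j⟩
    · simp only [sumDer, sumPick, opsOf_zero, argsOf_zero, opsOf_succ, zero_add,
        ← ih (fun Fs U => Q Fs (x a :: U)) fun u P Fs U => h u P Fs _]
      rw [argsOf_succ]
      abel
    · have h' : ∀ u P Fs U, Q (some (x a, j) :: (P ++ some (u, 0) :: Fs)) U
          = Q (some (x a, j) :: some (u, 0) :: (P ++ Fs)) U := fun u P Fs U => by
        have h1 := h u (some (x a, j) :: P) Fs U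
        have h2 := h u [some (x a, j)] (P ++ Fs) U
        simp only [List.cons_append, List.nil_append] at h1 h2
        rw [h1, h2]
      simp only [sumDer, sumDerOps, opsOf_succ, argsOf_succ,
        ← ih (fun Fs U => Q (some (x a, j) :: Fs) U) h']
      have h3 : ∀ u U, Q (some (u, 0) :: some (x a, j) :: opsOf x I) U
          = Q (some (x a, j) :: some (u, 0) :: opsOf x I) U := fun u U =>
        (h u [some (x a, j)] (opsOf x I) U).symm
      simp only [h3]
      abel

theorem sumDerOps_replicate (Q : List (OpSym A) → M) (e : ℕ) (Fs : List (OpSym A)) :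
    sumDerOps Q (List.replicate e none ++ Fs)
      = sumDerOps (fun Gs => Q (List.replicate e none ++ Gs)) Fs := by
  induction e generalizing Q with
  | zero => rfl
  | succ e ih => simp only [List.replicate_succ, List.cons_append, sumDerOps, ih]

theorem sumDerOps_congr {Q R : List (OpSym A) → M} (h : ∀ Fs, Q Fs = R Fs)
    (Fs : List (OpSym A)) : sumDerOps Q Fs = sumDerOps R Fs := by
  rw [funext h]

end Sums

/-! ### Values of differential monomials and their products. -/

section Normal

variable {k : Type*} [Field k] {A : Type*} [AddCommGroup A] [Module k A] {m : Ops k GDDualOp A}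

theorem comp_zero_head (Fs : List (OpSym A)) (U : List A) : comp m Fs (0 :: U) = 0 :=
  map_zero_head (comp_add_head Fs) U

/-- Chain rule: on the right, the two terms with (value of `F`) ⋆ `b` in the first slot of `H`
cancel. -/
theorem lieD_compose {F H : List A → A} (hH : ∀ a b U, H ((a + b) :: U) = H (a :: U) + H (b :: U))
    (r : ℕ) (b : A) (l : List A) :
    lieD m b l (fun l => H (F (l.take r) :: l.drop r)) =
      H (lieD m b (l.take r) F :: l.drop r) + lieD m b (F (l.take r) :: l.drop r) H := by
  induction l generalizing F r with
  | nil => simp [lieD]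
  | cons z l ih =>
    cases r with
    | zero => simp [lieD]
    | succ r =>
      simp only [lieD, List.take_succ_cons, List.drop_succ_cons] at ih ⊢
      rw [ih (F := fun l => F (z :: l)), map_sub_head hH]
      abel

theorem lieD_comp (hm : GDDualIdentities m) (b : A) (Fs : List (OpSym A)) (U : List A)
    (hU : wtSum Fs + 1 ≤ U.length) :
    lieD m b U (comp m Fs) = sumDerOps (fun Gs => comp m Gs (b :: U)) Fs := by
  induction Fs generalizing U with
  | nil =>
    rcases U with _ | ⟨u, _ | ⟨v, U⟩⟩
    · simp at hU
    · simp [lieD, comp, sumDerOps]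
    · simp [lieD, comp, sumDerOps, lieD_zero]
  | cons F Fs ih =>
    simp only [wtSum, List.map_cons, List.sum_cons] at hU ih
    -- If the derivative falls on a later operation, symmetry moves `b` past the arguments of `F`.
    have e (Gs : List (OpSym A)) : comp m (F :: Gs) (b :: U)
        = comp m Gs (b :: F.fn m (U.take (F.wt + 1)) :: U.drop (F.wt + 1)) := by
      have p : (b :: U).Perm (U.take (F.wt + 1) ++ b :: U.drop (F.wt + 1)) := by
        conv_lhs => rw [← List.take_append_drop (F.wt + 1) U]
        exact List.perm_middle.symm
      rw [permInv_comp hm _ _ _ p, comp_cons_append _ _ (by simp; omega),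
        permInv_comp hm _ _ _ (List.Perm.swap b _ _)]
    have h1 : lieD m b U (comp m (F :: Fs)) = _ :=
      lieD_compose (comp_add_head Fs) (F := F.fn m) (F.wt + 1) b U
    rw [h1, ih _ (by simp; omega), ← sumDerOps_congr e]
    rcases F with _ | ⟨x, j⟩
    · simp only [sumDerOps, OpSym.fn, lieD_astOp hm, comp_zero_head, zero_add]
    · simp only [sumDerOps, OpSym.fn, OpSym.wt]
      congr 1
      simp only [comp, OpSym.fn, OpSym.wt, List.take_succ_cons, List.drop_succ_cons,
        derOp_succ _ (j + 1)]
      rfl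

/-- The picked terms are those subtracted in `lieD`, with the changed entry moved to the front by
symmetry. -/
theorem star_eq_lieD_add {K : List A → A} (hK : PermInv K) (b : A) (U : List A) :
    m .star (K U) b = lieD m b U K + sumPick (fun u l => K (m .star u b :: l)) U := by
  induction U generalizing K with
  | nil => simp [lieD, sumPick]
  | cons z U ih =>
    simp only [lieD, sumPick]
    rw [ih (hK.cons z)]
    simp only [fun u l => hK _ _ (List.Perm.swap u z l)]
    abel

variable {α : Type*} (x : α → A)

variable (m) in
/-- The value of a differential monomial `I` with `ord I < I.length`. -/
def normalValue (I : List (α × ℕ)) : A :=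
  comp m (List.replicate (I.length - 1 - ord I) none ++ opsOf x I) (argsOf x I)

theorem normalValue_perm (hm : GDDualIdentities m) {I J : List (α × ℕ)} (p : I.Perm J)
    (hI : ord I + 1 ≤ I.length) : normalValue m x I = normalValue m x J := by
  have h : ord I = ord J := (p.map _).sum_eq
  rw [normalValue, normalValue, comp_perm hm _ _ (length_argsOf_eq x hI).ge,
    permInv_comp hm _ (argsOf x I) (argsOf x J) (p.filterMap _)]
  · rw [h, p.length_eq]
    exact (p.filterMap _).append_left _

theorem normalValue_ast (hm : GDDualIdentities m) {I J : List (α × ℕ)}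
    (hI : ord I + 1 ≤ I.length) (hJ : ord J + 1 ≤ J.length) :
    m .ast (normalValue m x I) (normalValue m x J) = normalValue m x (I ++ J) := by
  have lI := length_argsOf_eq x hI
  have lJ := length_argsOf_eq x hJ
  have lIJ := length_argsOf_eq x (I := I ++ J) (by simp [ord] at hI hJ ⊢; omega)
  -- One copy of ∗ beyond those of the two factors: the one that multiplies them.
  have he : (I ++ J).length - 1 - ord (I ++ J)
      = (J.length - 1 - ord J) + ((I.length - 1 - ord I) + 1) := by
    simp [ord] at hI hJ ⊢; omega
  rw [normalValue.eq_def m x (I ++ J)]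
  rw [he] at lIJ ⊢
  rw [opsOf_append, argsOf_append] at lIJ ⊢
  unfold normalValue
  set e := I.length - 1 - ord I
  set e' := J.length - 1 - ord J
  rcases hU : argsOf x I with _ | ⟨u, U⟩
  · simp [hU] at lI
  rw [hU] at lIJ
  have h1 := (comp_pull hm none (List.replicate e none ++ opsOf x I) u
    [comp m (List.replicate e' none ++ opsOf x J) (argsOf x J)] U).symm
  simp only [OpSym.fn, astOp] at h1
  rw [h1]
  have h2 := comp_cons_append (m := m) none (List.replicate e none ++ opsOf x I)
    (X := [u, comp m (List.replicate e' none ++ opsOf x J) (argsOf x J)]) rfl U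
  simp only [OpSym.fn, astOp] at h2
  rw [← h2, List.cons_append, List.singleton_append, permInv_comp hm _ _ _ (List.Perm.swap _ u U),
    ← comp_append _ _ _ _ lJ,
    permInv_comp hm _ _ _ List.perm_append_comm]
  refine (comp_perm hm ?_ _ lIJ.ge).symm
  rw [← Multiset.coe_eq_coe]
  simp only [← List.replicate_append_replicate, List.replicate_one, ← Multiset.coe_add,
    ← Multiset.cons_coe, ← Multiset.singleton_add]
  abel

theorem normalValue_star (hm : GDDualIdentities m) {I J : List (α × ℕ)}
    (hI : ord I + 1 ≤ I.length) (hJ : ord J + 1 ≤ J.length) :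
    m .star (normalValue m x I) (normalValue m x J)
      = sumDer (fun I' => normalValue m x (I' ++ J)) I := by
  have lJ := length_argsOf_eq x hJ
  set b := normalValue m x J with hb
  set P : List (OpSym A) := List.replicate (I.length - 1 - ord I) none with hP
  have h1 : m .star (normalValue m x I) b
      = sumDer (fun I' => comp m (P ++ opsOf x I') (b :: argsOf x I')) I := by
    rw [normalValue, star_eq_lieD_add (permInv_comp hm _), lieD_comp hm _ _ _
      (length_argsOf_eq x hI).ge, sumDerOps_replicate,
      ← sumDer_eq x (fun Fs U => comp m (P ++ Fs) (b :: U))]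
    · congr 1
      congr 1
      funext u U
      rw [comp_insert hm]
      rfl
    · intro u P' Fs U
      rw [← List.append_assoc, comp_insert hm, comp_insert hm, List.append_assoc]
  rw [h1]
  refine sumDer_congr fun I' h2 h3 => ?_
  have hIJ : ord (I' ++ J) + 1 ≤ (I' ++ J).length := by
    simp [ord] at hI hJ h2 h3 ⊢; omega
  have lIJ := length_argsOf_eq x hIJ
  -- The additional derivative takes the place of the joining ∗, so the copies of ∗ just add up.
  have he : (I' ++ J).length - 1 - ord (I' ++ J)
      = (J.length - 1 - ord J) + (I.length - 1 - ord I) := by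
    simp [ord] at hI hJ h2 h3 ⊢; omega
  rw [hb, normalValue, normalValue, ← comp_append _ _ _ _ lJ]
  rw [he] at lIJ ⊢
  rw [opsOf_append, argsOf_append] at lIJ ⊢
  rw [permInv_comp hm _ _ _ List.perm_append_comm]
  refine (comp_perm hm ?_ _ lIJ.ge).symm
  rw [← Multiset.coe_eq_coe]
  simp only [hP, ← List.replicate_append_replicate, ← Multiset.coe_add]
  abel

theorem eval_eq_expandSum (hm : GDDualIdentities m) (t : Mon GDDualOp α) :
    t.eval m x = expandSum t (normalValue m x) := by
  induction t with
  | var a => rfl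
  | op o s t hs ht =>
    rw [Mon.eval, hs, ht, bilin_expandSum]
    cases o with
    | ast =>
      exact expandSum_congr fun I hI => expandSum_congr fun J hJ => normalValue_ast x hm hI hJ
    | star =>
      exact expandSum_congr fun I hI => expandSum_congr fun J hJ => normalValue_star x hm hI hJ

end Normal

/-! ### The embedding into differential polynomials. -/

section Differential

variable (k : Type*) [Field k]

/-- The operations `p ∗ q = pq` and `p ⋆ q = p'q` on a commutative differential algebra. -/
def diffOps {R : Type*} [CommRing R] [Algebra k R] (δ : R →ₗ[k] R) : Ops k GDDualOp R
  | .ast => LinearMap.mul k R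
  | .star => (LinearMap.mul k R).comp δ

variable (α : Type*)

/-- The derivation of the algebra of differential polynomials. -/
noncomputable def polyDer :
    Derivation k (MvPolynomial (α × ℕ) k) (MvPolynomial (α × ℕ) k) :=
  MvPolynomial.mkDerivation k fun i => MvPolynomial.X (i.1, i.2 + 1)

variable {α}

/-- The value of a monomial in `∗`, `⋆` in the algebra of differential polynomials. -/
noncomputable def diffEval (t : Mon GDDualOp α) : MvPolynomial (α × ℕ) k :=
  t.eval (diffOps k (polyDer k α).toLinearMap) fun a => MvPolynomial.X (a, 0)

theorem polyDer_prod (I : List (α × ℕ)) :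
    polyDer k α (I.map MvPolynomial.X).prod = sumDer (fun J => (J.map MvPolynomial.X).prod) I := by
  induction I with
  | nil => simp [sumDer]
  | cons i I ih =>
    rw [List.map_cons, List.prod_cons, Derivation.leibniz, ih, smul_eq_mul, smul_eq_mul,
      ← AddMonoidHom.coe_mulLeft, map_sumDer, sumDer, polyDer, MvPolynomial.mkDerivation_X,
      add_comm, mul_comm]
    simp

theorem diffEval_eq_expandSum (t : Mon GDDualOp α) :
    diffEval k t = expandSum t fun I => (I.map MvPolynomial.X).prod := by
  induction t with
  | var a => simp [diffEval, expandSum, Mon.eval]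
  | op o s t hs ht =>
    rw [diffEval] at hs ht ⊢
    rw [Mon.eval, hs, ht, bilin_expandSum]
    cases o with
    | ast => simp [expandSum, diffOps]
    | star =>
      refine congrArg _ (funext fun I => congrArg _ (funext fun J => ?_))
      simp only [diffOps, LinearMap.comp_apply, LinearMap.mul_apply', Derivation.coeFn_coe,
        polyDer_prod, List.map_append, List.prod_append]
      exact map_sumDer (AddMonoidHom.mulRight (J.map MvPolynomial.X).prod) _ I

variable {k} {A : Type*} [AddCommGroup A] [Module k A] {m : Ops k GDDualOp A}

/-- Free `GD^!`-algebras embed into algebras of differential polynomials. -/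
theorem exists_linearMap_diffEval (hm : GDDualIdentities m) (x : α → A) :
    ∃ Ψ : MvPolynomial (α × ℕ) k →ₗ[k] A, ∀ t : Mon GDDualOp α, Ψ (diffEval k t) = t.eval m x := by
  classical
  -- The ordering chosen by `toList` is harmless by `normalValue_perm`; monomials of order at least
  -- their length get a junk value but never occur.
  refine ⟨(MvPolynomial.basisMonomials (α × ℕ) k).constr k fun μ =>
    normalValue m x (Finsupp.toMultiset μ).toList, fun t => ?_⟩
  rw [diffEval_eq_expandSum, eval_eq_expandSum x hm]
  refine (map_expandSum (LinearMap.toAddMonoidHom (Module.Basis.constr _ k _)) t _).trans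
    (expandSum_congr fun I hI => ?_)
  have h : (I.map MvPolynomial.X).prod
      = MvPolynomial.basisMonomials (α × ℕ) k (Multiset.toFinsupp (I : Multiset (α × ℕ))) := by
    rw [MvPolynomial.coe_basisMonomials]
    clear hI
    induction I with
    | nil => simp
    | cons i I ih =>
      rw [List.map_cons, List.prod_cons, ih, ← Multiset.cons_coe, ← Multiset.singleton_add,
        map_add, Multiset.toFinsupp_singleton, MvPolynomial.X, MvPolynomial.monomial_mul, one_mul]
  rw [LinearMap.toAddMonoidHom_coe, h, Module.Basis.constr_basis, Multiset.toFinsupp_toMultiset]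
  refine (normalValue_perm x hm ?_ hI).symm
  rw [← Multiset.coe_eq_coe, Multiset.coe_toList]

end Differential

/-! ### Extension of scalars to commutative algebras. -/

section Tensor

variable {k : Type*} [Field k] {ι : Type*} {A : Type*} [AddCommGroup A] [Module k A]
  {R : Type*} [CommRing R] [Algebra k R]

/-- The extension of the operations of an algebra to its tensor product with a commutative
algebra. -/
noncomputable def tensorOps (R : Type*) [CommRing R] [Algebra k R] (m : Ops k ι A) :
    Ops k ι (A ⊗[k] R) :=
  fun i => TensorProduct.map₂ (m i) (LinearMap.mul k R)

theorem isDerivation_tensorOps (m : Ops k ι A) (δ : Derivation k R R) :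
    IsDerivation (tensorOps R m) (LinearMap.lTensor A δ.toLinearMap) := by
  intro i a b
  induction a with
  | zero => simp
  | add a a' h h' => simp only [map_add, LinearMap.add_apply, h, h']; abel
  | tmul a p =>
    induction b with
    | zero => simp
    | add b b' h h' => simp only [map_add, h, h']; abel
    | tmul b q =>
      simp [tensorOps, TensorProduct.tmul_add, mul_comm, add_comm]

/-- For multilinear monomials all exponents are 1, so the scalar factor is common to all terms of an
identity. -/
theorem eval_tensorOps {α : Type*} [Fintype α] [DecidableEq α] (m : Ops k ι A) (x : α → A)
    (r : α → R) (t : Mon ι α) :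
    t.eval (tensorOps R m) (fun i => x i ⊗ₜ r i) = t.eval m x ⊗ₜ ∏ a, r a ^ t.occ a := by
  induction t with
  | var b => simp [Mon.eval, Mon.occ, pow_ite]
  | op o s t hs ht =>
    simp [Mon.eval, Mon.occ, hs, ht, tensorOps, pow_add, Finset.prod_mul_distrib]

theorem Mon.eval_update_of_occ_eq_zero {α : Type*} [DecidableEq α] (m : Ops k ι A) (x : α → A)
    {i : α} (a : A) {t : Mon ι α} (h : t.occ i = 0) :
    t.eval m (Function.update x i a) = t.eval m x := by
  induction t with
  | var b =>
    have : b ≠ i := by simpa [Mon.occ] using h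
    simp [Mon.eval, this]
  | op o s t hs ht =>
    simp only [Mon.occ, Nat.add_eq_zero_iff] at h
    simp only [Mon.eval, hs h.1, ht h.2]

theorem Mon.exists_eval_update {α : Type*} [DecidableEq α] (m : Ops k ι A) (x : α → A)
    {i : α} {t : Mon ι α} (h : t.occ i = 1) :
    ∃ φ : A →ₗ[k] A, ∀ a, t.eval m (Function.update x i a) = φ a := by
  induction t with
  | var b =>
    have : b = i := by simpa [Mon.occ] using h
    exact ⟨LinearMap.id, fun a => by simp [Mon.eval, this]⟩
  | op o s t hs ht =>
    simp only [Mon.occ, Nat.add_eq_one_iff] at h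
    rcases h with ⟨h0, h1⟩ | ⟨h1, h0⟩
    · obtain ⟨φ, hφ⟩ := ht h1
      exact ⟨(m o (s.eval m x)).comp φ, fun a => by
        simp [Mon.eval, hφ, Mon.eval_update_of_occ_eq_zero m x a h0]⟩
    · obtain ⟨φ, hφ⟩ := hs h1
      exact ⟨((m o).flip (t.eval m x)).comp φ, fun a => by
        simp [Mon.eval, hφ, Mon.eval_update_of_occ_eq_zero m x a h0]⟩

/-- The value of a multilinear monomial as a multilinear map. -/
def MultMon.evalMultilinear {n : ℕ} (m : Ops k ι A) (t : MultMon ι n) :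
    MultilinearMap k (fun _ : Fin n => A) A where
  toFun x := t.1.eval m x
  map_update_add' {inst} x i a b := by
    obtain rfl : inst = instDecidableEqFin n := Subsingleton.elim _ _
    obtain ⟨φ, hφ⟩ := Mon.exists_eval_update m x (t.2 i)
    simp only [hφ, map_add]
  map_update_smul' {inst} x i c a := by
    obtain rfl : inst = instDecidableEqFin n := Subsingleton.elim _ _
    obtain ⟨φ, hφ⟩ := Mon.exists_eval_update m x (t.2 i)
    simp only [hφ, map_smul]

/-- A multilinear identity of an algebra holds on its tensor product with a commutative
algebra. -/
theorem holds_tensorOps {n : ℕ} {m : Ops k ι A} {f : MPoly k ι n} (hf : Holds m f) :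
    Holds (tensorOps R m) f := by
  have key : Finsupp.linearCombination k (MultMon.evalMultilinear (tensorOps R m)) f = 0 := by
    refine MultilinearMap.ext_of_span_eq_top (g := fun _ (p : A × R) => p.1 ⊗ₜ[k] p.2)
      (fun _ => ?_) fun j => ?_
    · rw [← TensorProduct.span_tmul_eq_top k A R]
      congr 1
      ext z
      simp
    · have h := congrArg (fun a : A => a ⊗ₜ[k] ∏ i, (j i).2) (hf fun i => (j i).1)
      simp only [MPoly.eval, Finsupp.linearCombination_apply, Finsupp.sum, TensorProduct.sum_tmul,
        TensorProduct.zero_tmul] at h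
      simp only [Finsupp.linearCombination_apply, Finsupp.sum, sum_apply,
        smul_apply, zero_apply]
      rw [← h]
      refine Finset.sum_congr rfl fun t _ => ?_
      have ht := eval_tensorOps m (fun i => (j i).1) (fun i => (j i).2) t.1
      simp only [t.2, pow_one] at ht
      rw [← TensorProduct.smul_tmul', ← ht]
      rfl
  intro x
  have := congrArg (fun φ => φ x) key
  simpa [MPoly.eval, Finsupp.linearCombination_apply, Finsupp.sum,
    MultMon.evalMultilinear] using this

/-- For ≺ the second factor is pq' = q'p = q ⋆ p, by commutativity of `R`; this is why `Mon.snd`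
reverses the arguments. -/
theorem eval_derivedOps_tensorOps {α : Type*} (m : Ops k ι A) (δ : R →ₗ[k] R)
    (x : α → A) (r : α → R) (t : Mon (ι × DOp) α) :
    t.eval (derivedOps (tensorOps R m) (LinearMap.lTensor A δ)) (fun i => x i ⊗ₜ r i) =
      t.fst.eval m x ⊗ₜ t.snd.eval (diffOps k δ) r := by
  induction t with
  | var a => rfl
  | op o s t hs ht =>
    rcases o with ⟨i, o | o | o⟩ <;>
      simp [Mon.eval, Mon.fst, Mon.snd, derivedOps, hs, ht, tensorOps, diffOps, mul_comm]

end Tensor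

/-! ### From generalized derived identities to the white product. -/

theorem variety_tensorOps {k : Type u} [Field k] {ι : Type v} {rel : ∀ n : ℕ, Set (MPoly k ι n)}
    {A : Type max u v} [AddCommGroup A] [Module k A] {m : Ops k ι A}
    (hA : Variety.{u, v, max u v} rel A m) (R : Type u) [CommRing R] [Algebra k R] :
    Variety.{u, v, max u v} rel (A ⊗[k] R) (tensorOps R m) :=
  fun n f hf => holds_tensorOps (hA n f hf)

/-- An element of `M ⊗ N` vanishes if its contractions with all functionals on `N` do. -/
theorem tensor_eq_zero_of_functionals {k : Type*} [Field k] {M N : Type*} [AddCommGroup M]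
    [Module k M] [AddCommGroup N] [Module k N] (z : M ⊗[k] N)
    (h : ∀ φ : N →ₗ[k] k, TensorProduct.rid k M (LinearMap.lTensor M φ z) = 0) : z = 0 := by
  classical
  let b := Module.Basis.ofVectorSpace k N
  have key (i) (z : M ⊗[k] N) : TensorProduct.equivFinsuppOfBasisRight b z i
      = TensorProduct.rid k M (LinearMap.lTensor M (b.coord i) z) := by
    induction z with
    | zero => simp
    | add z z' hz hz' => rw [map_add, Finsupp.add_apply, hz, hz', map_add, map_add]
    | tmul x y => simp
  apply (TensorProduct.equivFinsuppOfBasisRight (M := M) b).injective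
  ext i
  rw [key, h, map_zero, Finsupp.zero_apply]

/-- Over a field, a linear map factors through another one with a smaller kernel. -/
theorem exists_comp_eq_of_ker_le {k : Type*} [Field k] {X Y Z : Type*} [AddCommGroup X]
    [Module k X] [AddCommGroup Y] [Module k Y] [AddCommGroup Z] [Module k Z] (p : X →ₗ[k] Y)
    (g : X →ₗ[k] Z) (h : LinearMap.ker p ≤ LinearMap.ker g) : ∃ q : Y →ₗ[k] Z, q ∘ₗ p = g := by
  obtain ⟨s, hs⟩ := p.rangeRestrict.exists_rightInverse_of_surjective p.range_rangeRestrict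
  obtain ⟨q, hq⟩ := (g ∘ₗ s).exists_extend
  refine ⟨q, LinearMap.ext fun x => ?_⟩
  have h1 : q (p x) = g (s (p.rangeRestrict x)) := LinearMap.congr_fun hq (p.rangeRestrict x)
  have h2 : s (p.rangeRestrict x) - x ∈ LinearMap.ker p := by
    have := congrArg Subtype.val (LinearMap.congr_fun hs (p.rangeRestrict x))
    simpa [sub_eq_zero] using this
  rw [LinearMap.comp_apply, h1, ← sub_eq_zero, ← map_sub]
  exact h h2

/-- A generalized derived identity vanishes in the Hadamard product of the operad of the variety
and the operad of differential polynomials. -/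
theorem sum_tmul_diffEval_eq_zero {k : Type u} [Field k] {ι : Type v}
    (rel : ∀ n : ℕ, Set (MPoly k ι n)) {n : ℕ} {f : MPoly k (ι × DOp) n}
    (hf : IsGenDerivedIdentity (Variety.{u, v, max u v} rel) f) :
    f.sum (fun t c => c • ((identities (Variety.{u, v, max u v} rel) n).mkQ
      (Finsupp.single (MultMon.fst t) 1) ⊗ₜ[k] diffEval k t.snd.1)) = 0 := by
  refine tensor_eq_zero_of_functionals _ fun φ => ?_
  have e : TensorProduct.rid k _ (LinearMap.lTensor _ φ (f.sum fun t c =>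
      c • ((identities (Variety.{u, v, max u v} rel) n).mkQ
        (Finsupp.single (MultMon.fst t) 1) ⊗ₜ[k] diffEval k t.snd.1)))
      = (identities (Variety.{u, v, max u v} rel) n).mkQ
        (f.sum fun t c => c • φ (diffEval k t.snd.1) • Finsupp.single (MultMon.fst t) 1) := by
    simp only [Finsupp.sum, map_sum, map_smul, LinearMap.lTensor_tmul, TensorProduct.rid_tmul]
  rw [e, Submodule.mkQ_apply, Submodule.Quotient.mk_eq_zero]
  -- The contraction is a polynomial in Var(n); it is zero there once it is an identity of every `A`
  -- in the variety, which is tested on A ⊗ R at the points x_i ⊗ X_i.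
  intro A _ _ m hA x
  have h := hf _ _ (variety_tensorOps hA (MvPolynomial (Fin n × ℕ) k)) _
    (isDerivation_tensorOps m (polyDer k (Fin n))) fun i => x i ⊗ₜ MvPolynomial.X (i, 0)
  replace h := congrArg (fun z => TensorProduct.rid k _ (LinearMap.lTensor _ φ z)) h
  simp only [MPoly.eval, Finsupp.linearCombination_apply, eval_derivedOps_tensorOps, Finsupp.sum,
    map_sum, map_smul, LinearMap.lTensor_tmul, TensorProduct.rid_tmul, map_zero] at h
  rw [← h]
  simp only [MPoly.eval, Finsupp.sum, map_sum, map_smul, Finsupp.linearCombination_single, one_smul]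
  rfl

/-- Multilinear polynomials in `∗`, `⋆` that vanish on differential polynomials are identities of
`GD^!`-algebras. -/
theorem ker_diffEval_le_identities (k : Type u) [Field k] (n : ℕ) :
    LinearMap.ker (Finsupp.linearCombination k fun t : MultMon GDDualOp n => diffEval k t.1) ≤
      identities (GDDual k) n := by
  intro g hg A _ _ m hm x
  obtain ⟨Ψ, hΨ⟩ := exists_linearMap_diffEval ((isGDDual_iff m).1 hm) x
  rw [LinearMap.mem_ker] at hg
  rw [← map_zero Ψ, ← hg]
  simp [MPoly.eval, Finsupp.linearCombination_apply, Finsupp.sum, hΨ]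

theorem whiteMap_eq_zero {k : Type u} [Field k] {ι : Type v}
    (rel : ∀ n : ℕ, Set (MPoly k ι n)) {n : ℕ} {f : MPoly k (ι × DOp) n}
    (hf : IsGenDerivedIdentity (Variety.{u, v, max u v} rel) f) :
    whiteMap (Variety.{u, v, max u v} rel) n f = 0 := by
  -- By the embedding, the class in GD^!(n) is a linear function of the differential polynomial.
  obtain ⟨q, hq⟩ : ∃ q : MvPolynomial (Fin n × ℕ) k →ₗ[k] OperadComp (GDDual k) n,
      q ∘ₗ (Finsupp.linearCombination k fun t : MultMon GDDualOp n => diffEval k t.1)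
        = (identities (GDDual k) n).mkQ :=
    exists_comp_eq_of_ker_le _ _ (by rw [Submodule.ker_mkQ]; exact ker_diffEval_le_identities k n)
  have hq' (t : MultMon GDDualOp n) :
      (identities (GDDual k) n).mkQ (Finsupp.single t 1) = q (diffEval k t.1) := by
    rw [← hq]; simp
  have h := congrArg (LinearMap.lTensor _ q) (sum_tmul_diffEval_eq_zero rel hf)
  rw [map_zero] at h
  rw [← h, whiteMap, Finsupp.linearCombination_apply]
  simp only [Finsupp.sum, map_sum, map_smul, LinearMap.lTensor_tmul, hq']

end GDWhite

theorem mainTheorem1 {k : Type u} [Field k] {ι : Type v}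
    (rel : ∀ n : ℕ, Set (GDWhite.MPoly k ι n)) {n : ℕ} (f : GDWhite.MPoly k (ι × GDWhite.DOp) n)
    (hf : GDWhite.IsGenDerivedIdentity (GDWhite.Variety.{u, v, max u v} rel) f)
    {B : Type w} [AddCommGroup B] [Module k B] (m : GDWhite.Ops k (ι × GDWhite.DOp) B)
    (hm : GDWhite.IsWhiteAlgebra (GDWhite.Variety.{u, v, max u v} rel) m) :
    GDWhite.Holds m f :=
  hm n f (GDWhite.whiteMap_eq_zero rel hf)
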